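/- Let $p$ and $r$ be primes with $r \neq p$. Identify the monic polynomial $x^r + c_{r-1}x^{r-1} + \cdots + c_1 x + c_0 \in \mathbb{Z}_p[x]$ with the point $(c_{r-1},\dots,c_0) \in \mathbb{Z}_p^r$, and equip $\mathbb{Z}_p^r$ with its Haar measure of total mass $1$. Then the set of monic polynomials of degree $r$ that are irreducible in $\mathbb{Z}_p[x]$ (that is, not a product of two nonconstant polynomials in $\mathbb{Z}_p[x]$) is measurable, and its measure $I$ is \[ I = \frac{(p^r-p)\left(1-p^{-(r+1)/2}\right) + r(p-1)\left(1-p^{-(r+1)(r-1)/2}\right)}{r\,p^r\left(1-p^{-r(r+1)/2+1}\right)\left(1-p^{-(r+1)/2}\right)}. \] -/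

import Mathlib

open MeasureTheory Polynomial

noncomputable section

/-- The ring `ℤ_p` carries its Borel σ-algebra. -/
instance padicIntMeasurableSpace (p : ℕ) [Fact p.Prime] : MeasurableSpace ℤ_[p] :=
  borel ℤ_[p]

instance padicIntBorelSpace (p : ℕ) [Fact p.Prime] : BorelSpace ℤ_[p] := ⟨rfl⟩

instance padicIntSecondCountable (p : ℕ) [Fact p.Prime] : SecondCountableTopology ℤ_[p] :=
  inferInstance

/-- The Haar measure on the compact additive group `ℤ_p ^ n`, normalised so that the whole group
has measure one. -/
def haarPadicInt (p n : ℕ) [Fact p.Prime] : Measure (Fin n → ℤ_[p]) :=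
  Measure.addHaarMeasure ⊤

instance haarPadicInt_isAddHaarMeasure (p n : ℕ) [Fact p.Prime] :
    (haarPadicInt p n).IsAddHaarMeasure :=
  inferInstanceAs (Measure.IsAddHaarMeasure (Measure.addHaarMeasure ⊤))

instance haarPadicInt_isProbabilityMeasure (p n : ℕ) [Fact p.Prime] :
    IsProbabilityMeasure (haarPadicInt p n) :=
  ⟨Measure.addHaarMeasure_self (K₀ := (⊤ : TopologicalSpace.PositiveCompacts (Fin n → ℤ_[p])))⟩

/-- The monic polynomial `x ^ n + c_{n-1} x ^ (n-1) + ⋯ + c_1 x + c_0` in `ℤ_p[x]` attached to the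
coefficient vector `c`. -/
def monicPoly (p n : ℕ) [Fact p.Prime] (c : Fin n → ℤ_[p]) : ℤ_[p][X] :=
  X ^ n + ∑ i : Fin n, C (c i) * X ^ (i : ℕ)

/-- The coefficient vectors of the monic polynomials of degree `n` which are irreducible in
`ℤ_p[x]`. -/
def irreducibleMonic (p n : ℕ) [Fact p.Prime] : Set (Fin n → ℤ_[p]) :=
  {c | Irreducible (monicPoly p n c)}

end

/-! The set of irreducible polynomials is self-similar, which gives a linear equation for `I`.
Modulo `p`, an irreducible `f` of prime degree `r` is either irreducible or `(X - a) ^ r`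
(`irreducible_map_toZMod_or_eq_pow`). Conversely, every lift of an irreducible polynomial is
irreducible, so the first case contributes `N / p ^ r`, where `r * N = p ^ r - p` counts the
irreducible residues. Translating the variable preserves Haar measure, so the `p` values of `a`
contribute equally, and `I = N / p ^ r + p * J` with `J` the contribution of `a = 0`.

For `a = 0`, sort by the valuation `m` of the constant coefficient. All roots of an irreducible `f`
have the same absolute value, so its Newton polygon is the segment from `(0, m)` to `(r, 0)`. If `0
< m < r`, that condition also suffices: the roots have valuation `m / r`, which forces degree `r`.
It cuts out a difference of two boxes, of measure `(p - 1) * q ^ (m + 1)` with `q = p ^ (-(r + 1) /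
2)`. If `m ≥ r`, dividing the roots by `p` gives an arbitrary irreducible polynomial, and the
coefficients scale the measure by `q ^ r`.

Hence `J = (p - 1) * ∑ q ^ (m + 1) + q ^ r * I`, and solving for `I` gives the formula. The
decomposition is `irreducibleMonic_inter_residueClass_zero` together with
`irreducibleMonic_eq_union`. -/

/-! ### Newton polygons and irreducibility over `ℤ_[p]` -/

instance PadicAlgCl.isTorsionFree_padicInt (p : ℕ) [Fact p.Prime] :
    Module.IsTorsionFree ℤ_[p] (PadicAlgCl p) :=
  .trans_faithfulSMul ℤ_[p] ℚ_[p] (PadicAlgCl p)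

theorem PadicAlgCl.norm_algebraMap_padicInt {p : ℕ} [Fact p.Prime] (x : ℤ_[p]) :
    ‖algebraMap ℤ_[p] (PadicAlgCl p) x‖ = ‖x‖ := by
  rw [IsScalarTower.algebraMap_apply ℤ_[p] ℚ_[p] (PadicAlgCl p)]
  exact PadicAlgCl.norm_extends p (x : ℚ_[p])

/-- The norm of an algebraic `p`-adic number in terms of the constant coefficient of its minimal
polynomial. -/
theorem PadicAlgCl.norm_pow_natDegree_minpoly {p : ℕ} [Fact p.Prime] (α : PadicAlgCl p) :
    ‖α‖ ^ (minpoly ℚ_[p] α).natDegree = ‖(minpoly ℚ_[p] α).coeff 0‖ := by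
  have h0 : (minpoly ℚ_[p] α).natDegree ≠ 0 :=
    (minpoly.natDegree_pos (Algebra.IsIntegral.isIntegral α)).ne'
  rw [← PadicAlgCl.spectralNorm_eq, spectralNorm.spectralNorm_eq_norm_coeff_zero_rpow, one_div,
    Real.rpow_inv_natCast_pow (norm_nonneg _) h0]

/-- The norm is the spectral norm, a supremum of terms `‖a_i‖ ^ (1 / (n - i))`; each term is bounded
by the supremum. -/
theorem PadicAlgCl.norm_coeff_minpoly_le {p : ℕ} [Fact p.Prime] (α : PadicAlgCl p) {i : ℕ}
    (hi : i < (minpoly ℚ_[p] α).natDegree) :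
    ‖(minpoly ℚ_[p] α).coeff i‖ ≤ ‖α‖ ^ ((minpoly ℚ_[p] α).natDegree - i) := by
  have h := le_ciSup (spectralValueTerms_bddAbove (minpoly ℚ_[p] α)) i
  rw [spectralValueTerms_of_lt_natDegree _ hi] at h
  replace h : _ ≤ ‖α‖ := h
  have h0 : (minpoly ℚ_[p] α).natDegree - i ≠ 0 := by omega
  have h2 := pow_le_pow_left₀ (Real.rpow_nonneg (norm_nonneg _) _) h
    ((minpoly ℚ_[p] α).natDegree - i)
  rwa [← Nat.cast_sub hi.le, one_div, Real.rpow_inv_natCast_pow (norm_nonneg _) h0] at h2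

/-- A monic irreducible `p`-adic polynomial is the minimal polynomial of some `α`. -/
theorem exists_minpoly_eq_of_irreducible {p : ℕ} [Fact p.Prime] {f : ℤ_[p][X]} (hf : f.Monic)
    (hirr : Irreducible f) :
    ∃ α : PadicAlgCl p, aeval α f = 0 ∧ minpoly ℚ_[p] α = f.map (algebraMap ℤ_[p] ℚ_[p]) := by
  have hirr' := (hf.irreducible_iff_irreducible_map_fraction_map (K := ℚ_[p])).1 hirr
  obtain ⟨α, hα⟩ := IsAlgClosed.exists_aeval_eq_zero (PadicAlgCl p)
    (f.map (algebraMap ℤ_[p] ℚ_[p])) (degree_pos_of_irreducible hirr').ne'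
  refine ⟨α, ?_, (minpoly.eq_of_irreducible_of_monic hirr' hα (hf.map _)).symm⟩
  rwa [aeval_map_algebraMap] at hα

/-- The Newton polygon of a monic irreducible polynomial over `ℤ_[p]` is a segment. -/
theorem norm_coeff_pow_le_of_irreducible {p : ℕ} [Fact p.Prime] {f : ℤ_[p][X]} (hf : f.Monic)
    (hirr : Irreducible f) {i : ℕ} (hi : i < f.natDegree) :
    ‖f.coeff i‖ ^ f.natDegree ≤ ‖f.coeff 0‖ ^ (f.natDegree - i) := by
  obtain ⟨α, -, hα⟩ := exists_minpoly_eq_of_irreducible hf hirr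
  have h1 := PadicAlgCl.norm_pow_natDegree_minpoly α
  have h2 := PadicAlgCl.norm_coeff_minpoly_le α (i := i)
  rw [hα, hf.natDegree_map] at h1 h2
  rw [coeff_map] at h1 h2
  have h3 : ∀ x : ℤ_[p], ‖algebraMap ℤ_[p] ℚ_[p] x‖ = ‖x‖ := fun _ => rfl
  rw [h3] at h1 h2
  rw [← h1, ← pow_mul, mul_comm, pow_mul]
  exact pow_le_pow_left₀ (norm_nonneg _) (h2 hi) _

/-- Were the sum zero, the dominant term would have the norm of the remaining sum, which is at most
the norm of one of the other terms. -/
theorem IsUltrametricDist.sum_ne_zero_of_dominant {M ι : Type*} [SeminormedAddCommGroup M]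
    [IsUltrametricDist M] {s : Finset ι} {t : ι → M} {j : ι} (hj : j ∈ s)
    (hpos : 0 < ‖t j‖) (h : ∀ i ∈ s, i ≠ j → ‖t i‖ < ‖t j‖) : ∑ i ∈ s, t i ≠ 0 := by
  classical
  intro h0
  rw [← Finset.add_sum_erase s t hj] at h0
  have h1 : ‖t j‖ = ‖∑ i ∈ s.erase j, t i‖ := by rw [eq_neg_of_add_eq_zero_left h0, norm_neg]
  rcases (s.erase j).eq_empty_or_nonempty with he | hne
  · rw [he, Finset.sum_empty, norm_zero] at h1
    exact hpos.ne' h1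
  · have : Nonempty ι := ⟨j⟩
    obtain ⟨i, hi, hle⟩ := IsUltrametricDist.exists_norm_finsetSum_le (s.erase j) t
    have := Finset.mem_erase.1 (hi hne)
    exact absurd (h i this.2 this.1) (not_lt.2 (h1 ▸ hle))

/-- A root of a polynomial whose Newton polygon is the segment from `(0, m)` to `(r, 0)` has
valuation `m / r`. -/
theorem norm_pow_eq_of_newton_segment {p : ℕ} [Fact p.Prime] {f : ℤ_[p][X]} (hf : f.Monic)
    {α : PadicAlgCl p} (hα : aeval α f = 0) (h0 : f.coeff 0 ≠ 0)
    (h : ∀ i < f.natDegree, ‖f.coeff i‖ ^ f.natDegree ≤ ‖f.coeff 0‖ ^ (f.natDegree - i)) :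
    ‖α‖ ^ f.natDegree = ‖f.coeff 0‖ := by
  set r := f.natDegree with hr
  have hpos : 0 < ‖f.coeff 0‖ := norm_pos_iff.2 h0
  have hterm : ∀ i, ‖algebraMap ℤ_[p] (PadicAlgCl p) (f.coeff i) * α ^ i‖
      = ‖f.coeff i‖ * ‖α‖ ^ i := fun i => by
    rw [norm_mul, norm_pow, PadicAlgCl.norm_algebraMap_padicInt]
  have hterm' : ∀ i < r, (‖f.coeff i‖ * ‖α‖ ^ i) ^ r ≤ ‖f.coeff 0‖ ^ (r - i) * (‖α‖ ^ r) ^ i :=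
    fun i hi => by
      rw [mul_pow, ← pow_mul, ← pow_mul, mul_comm i r]
      exact mul_le_mul_of_nonneg_right (h i hi) (by positivity)
  have hlead : f.coeff r = 1 := hf
  have hr0 : r ≠ 0 := by
    intro h0
    have : f = 1 := hf.natDegree_eq_zero.1 h0
    simp [this] at hα
  have hsum := hα
  rw [aeval_eq_sum_range] at hsum
  simp only [Algebra.smul_def, ← hr] at hsum
  -- If `‖α‖` is too small the constant term of `f(α) = 0` dominates; if it is too large the leading
  -- term does.
  rcases lt_trichotomy (‖α‖ ^ r) ‖f.coeff 0‖ with hlt | heq | hlt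
  · refine absurd hsum (IsUltrametricDist.sum_ne_zero_of_dominant (j := 0) (by simp) ?_ ?_)
    · rwa [hterm, pow_zero, mul_one]
    · intro i hi hi0
      rw [hterm, hterm, pow_zero, mul_one]
      refine lt_of_pow_lt_pow_left₀ r hpos.le ?_
      rcases (Nat.lt_succ_iff.1 (Finset.mem_range.1 hi)).eq_or_lt with rfl | hir
      · rw [hlead, norm_one, one_mul]
        exact pow_lt_pow_left₀ hlt (by positivity) hr0
      · refine (hterm' i hir).trans_lt ?_
        calc _ < ‖f.coeff 0‖ ^ (r - i) * ‖f.coeff 0‖ ^ i := by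
              refine mul_lt_mul_of_pos_left ?_ (by positivity)
              exact pow_lt_pow_left₀ hlt (by positivity) hi0
          _ = _ := by rw [← pow_add]; congr 1; omega
  · exact heq
  · have hα0 : 0 < ‖α‖ ^ r := hpos.trans hlt
    refine absurd hsum (IsUltrametricDist.sum_ne_zero_of_dominant (j := r) (by simp) ?_ ?_)
    · simpa [hterm, hlead] using hα0
    · intro i hi hir
      rw [hterm, hterm, hlead, norm_one, one_mul]
      have hir' : i < r := by have := Finset.mem_range.1 hi; omega
      refine lt_of_pow_lt_pow_left₀ r (by positivity) ((hterm' i hir').trans_lt ?_)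
      calc _ < (‖α‖ ^ r) ^ (r - i) * (‖α‖ ^ r) ^ i := by
              refine mul_lt_mul_of_pos_right ?_ (pow_pos hα0 _)
              exact pow_lt_pow_left₀ hlt (by positivity) (by omega)
        _ = _ := by rw [← pow_add]; congr 1; omega

/-- A polynomial of prime degree `r` over `ℤ_[p]` whose Newton polygon is a segment of slope
`m / r` with `r ∤ m` is irreducible. -/
theorem irreducible_of_newton_segment {p : ℕ} [Fact p.Prime] {f : ℤ_[p][X]} (hf : f.Monic)
    (hr : f.natDegree.Prime) {m : ℕ} (hm : ¬ f.natDegree ∣ m)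
    (h0 : ‖f.coeff 0‖ = (p : ℝ) ^ (-(m : ℤ)))
    (h : ∀ i < f.natDegree, ‖f.coeff i‖ ^ f.natDegree ≤ ‖f.coeff 0‖ ^ (f.natDegree - i)) :
    Irreducible f := by
  have hp1 : (1 : ℝ) < p := by exact_mod_cast (Fact.out : p.Prime).one_lt
  have hp0 : (0 : ℝ) < p := by linarith
  have hc0 : f.coeff 0 ≠ 0 := by
    rw [← norm_ne_zero_iff, h0]; positivity
  set F := f.map (algebraMap ℤ_[p] ℚ_[p]) with hF
  have hFm : F.Monic := hf.map _
  have hFd : F.natDegree = f.natDegree := hf.natDegree_map _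
  obtain ⟨α, hα⟩ := IsAlgClosed.exists_aeval_eq_zero (PadicAlgCl p) F
    (natDegree_pos_iff_degree_pos.1 (hFd ▸ hr.pos)).ne'
  have hαf : aeval α f = 0 := by rwa [hF, aeval_map_algebraMap] at hα
  have hα1 := norm_pow_eq_of_newton_segment hf hαf hc0 h
  have hα2 := PadicAlgCl.norm_pow_natDegree_minpoly α
  have hint : IsIntegral ℚ_[p] α := Algebra.IsIntegral.isIntegral α
  have hs := minpoly.natDegree_pos hint
  have hdvd : minpoly ℚ_[p] α ∣ F := minpoly.dvd _ _ hα
  have hle := natDegree_le_of_dvd hdvd hFm.ne_zero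
  have hαpos : 0 < ‖α‖ ^ f.natDegree := by rw [hα1]; exact norm_pos_iff.2 hc0
  have hα0 : ‖α‖ ≠ 0 := fun h => by simp [h, hr.ne_zero] at hαpos
  have hc : (minpoly ℚ_[p] α).coeff 0 ≠ 0 := by
    rw [← norm_ne_zero_iff, ← hα2]; exact pow_ne_zero _ hα0
  -- With `s` the degree of `α` and `v` the valuation of its norm, comparing absolute values gives
  -- `m * s = v * r`; as `r` is prime and `r ∤ m`, it divides `s`.
  have hrs : f.natDegree ∣ (minpoly ℚ_[p] α).natDegree := by
    have key : (p : ℝ) ^ (-(m : ℤ) * ((minpoly ℚ_[p] α).natDegree : ℤ))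
        = (p : ℝ) ^ (-((minpoly ℚ_[p] α).coeff 0).valuation * (f.natDegree : ℤ)) := by
      rw [zpow_mul, zpow_mul, ← h0, ← Padic.norm_eq_zpow_neg_valuation hc, ← hα1, ← hα2]
      simp only [zpow_natCast]
      rw [← pow_mul, ← pow_mul, mul_comm]
    have key2 := zpow_right_injective₀ hp0 hp1.ne' key
    have : (f.natDegree : ℤ) ∣ (m : ℤ) * ((minpoly ℚ_[p] α).natDegree : ℤ) :=
      ⟨((minpoly ℚ_[p] α).coeff 0).valuation, by linarith⟩
    exact ((hr.dvd_mul).1 (by exact_mod_cast this)).resolve_left hm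
  have hrs' := Nat.le_of_dvd hs hrs
  have hEq : minpoly ℚ_[p] α = F :=
    (eq_of_monic_of_dvd_of_natDegree_le (minpoly.monic hint) hFm hdvd (by omega)).symm
  rw [hf.irreducible_iff_irreducible_map_fraction_map (K := ℚ_[p]), ← hF, ← hEq]
  exact minpoly.irreducible hint

/-! ### Reduction modulo `p` of irreducible polynomials -/

theorem isIntegral_aeval {R A : Type*} [CommRing R] [CommRing A] [Algebra R A] {x : A}
    (hx : IsIntegral R x) (q : R[X]) : IsIntegral R (aeval x q) :=
  (integralClosure R A).aeval_coe ⟨x, hx⟩ q ▸ (aeval (⟨x, hx⟩ : integralClosure R A) q).2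

theorem PadicAlgCl.norm_aeval_le_one {p : ℕ} [Fact p.Prime] {α : PadicAlgCl p}
    (hα : IsIntegral ℤ_[p] α) (q : ℤ_[p][X]) : ‖aeval α q‖ ≤ 1 := by
  have hβ : IsIntegral ℤ_[p] (aeval α q) := isIntegral_aeval hα q
  set β := aeval α q
  have h := PadicAlgCl.norm_pow_natDegree_minpoly β
  rw [minpoly.isIntegrallyClosed_eq_field_fractions' ℚ_[p] hβ, coeff_map] at h
  have h1 : ‖β‖ ^ ((minpoly ℤ_[p] β).map (algebraMap ℤ_[p] ℚ_[p])).natDegree ≤ 1 :=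
    h.trans_le (PadicInt.norm_le_one _)
  rw [(minpoly.monic hβ).natDegree_map] at h1
  by_contra hlt
  exact absurd h1 (not_le.2 (one_lt_pow₀ (not_le.1 hlt) (minpoly.natDegree_pos hβ).ne'))

/-- If `‖a(α)‖ < 1` at a root `α` of a monic irreducible `f`, then `f` divides a power of `a`
modulo `p`. -/
theorem map_toZMod_dvd_pow_of_norm_lt_one {p : ℕ} [Fact p.Prime] {f a : ℤ_[p][X]}
    {α : PadicAlgCl p} (hint : IsIntegral ℤ_[p] α) (hα : minpoly ℤ_[p] α = f)
    (ha : ‖aeval α a‖ < 1) :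
    ∃ d, f.map (PadicInt.toZMod (p := p)) ∣ a.map PadicInt.toZMod ^ d := by
  have hβ : IsIntegral ℤ_[p] (aeval α a) := isIntegral_aeval hint a
  set β := aeval α a with hβdef
  set M := minpoly ℤ_[p] β with hM
  have hMm : M.Monic := minpoly.monic hβ
  have hMf : minpoly ℚ_[p] β = M.map (algebraMap ℤ_[p] ℚ_[p]) :=
    minpoly.isIntegrallyClosed_eq_field_fractions' ℚ_[p] hβ
  have hdvd : f ∣ M.comp a := by
    rw [← hα]
    refine minpoly.isIntegrallyClosed_dvd hint ?_
    rw [aeval_comp, ← hβdef]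
    exact minpoly.aeval _ _
  -- Since `‖β‖ < 1`, every nonleading coefficient of its minimal polynomial is divisible by `p`, so
  -- `M.comp a` reduces to a power of `a`.
  have hred : M.map (PadicInt.toZMod (p := p)) = X ^ M.natDegree := by
    ext i
    rw [coeff_map, coeff_X_pow]
    split_ifs with h
    · rw [h, hMm.coeff_natDegree, map_one]
    · rcases lt_or_gt_of_ne h with h | h
      · have h1 := PadicAlgCl.norm_coeff_minpoly_le β (i := i)
        rw [hMf, hMm.natDegree_map, coeff_map] at h1
        have h2 : ‖M.coeff i‖ < 1 :=
          lt_of_le_of_lt (h1 h) (pow_lt_one₀ (norm_nonneg _) ha (by omega))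
        rw [← RingHom.mem_ker, PadicInt.ker_toZMod, PadicInt.maximalIdeal_eq_span_p,
          Ideal.mem_span_singleton]
        exact (PadicInt.norm_lt_one_iff_dvd _).1 h2
      · rw [coeff_eq_zero_of_natDegree_lt h, map_zero]
  refine ⟨M.natDegree, ?_⟩
  have := Polynomial.map_dvd (PadicInt.toZMod (p := p)) hdvd
  rwa [Polynomial.map_comp, hred, X_pow_comp] at this

theorem toZMod_surjective {p : ℕ} [Fact p.Prime] :
    Function.Surjective (PadicInt.toZMod (p := p)) := ZMod.ringHom_surjective _

theorem exists_eq_C_mul_of_map_toZMod_eq_zero {p : ℕ} [Fact p.Prime] {q : ℤ_[p][X]}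
    (hq : q.map (PadicInt.toZMod (p := p)) = 0) : ∃ q', q = C (p : ℤ_[p]) * q' := by
  refine (C_dvd_iff_dvd_coeff _ _).2 fun i => ?_
  rw [← Ideal.mem_span_singleton, ← PadicInt.maximalIdeal_eq_span_p, ← PadicInt.ker_toZMod,
    RingHom.mem_ker, ← coeff_map, hq, coeff_zero]

/-- The reduction modulo `p` of a monic irreducible polynomial generates a primary ideal. -/
theorem map_toZMod_dvd_pow_or_dvd_pow {p : ℕ} [Fact p.Prime] {f : ℤ_[p][X]} (hf : f.Monic)
    (hirr : Irreducible f) {a b : (ZMod p)[X]}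
    (hab : f.map (PadicInt.toZMod (p := p)) ∣ a * b) :
    ∃ d, f.map (PadicInt.toZMod (p := p)) ∣ a ^ d ∨ f.map (PadicInt.toZMod (p := p)) ∣ b ^ d := by
  obtain ⟨A, rfl⟩ := map_surjective _ toZMod_surjective a
  obtain ⟨B, rfl⟩ := map_surjective _ toZMod_surjective b
  obtain ⟨c, hc⟩ := hab
  obtain ⟨c, rfl⟩ := map_surjective _ toZMod_surjective c
  obtain ⟨q, hq⟩ := exists_eq_C_mul_of_map_toZMod_eq_zero (q := A * B - f * c) (by
    simp [Polynomial.map_sub, Polynomial.map_mul, hc])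
  obtain ⟨α, hα, hmin⟩ := exists_minpoly_eq_of_irreducible hf hirr
  have hint : IsIntegral ℤ_[p] α := ⟨f, hf, by rwa [aeval_def] at hα⟩
  have hmin' : minpoly ℤ_[p] α = f := by
    rw [minpoly.isIntegrallyClosed_eq_field_fractions' ℚ_[p] hint] at hmin
    exact map_injective _ (IsFractionRing.injective ℤ_[p] ℚ_[p]) hmin
  have h1 : aeval α A * aeval α B = algebraMap ℤ_[p] (PadicAlgCl p) p * aeval α q := by
    have := congrArg (aeval α) hq
    rw [map_sub, map_mul, map_mul, map_mul, hα, zero_mul, sub_zero, aeval_C] at this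
    exact this
  -- The product is `p` times an integral element, so one of the two factors has norm less than `1`.
  have h2 : ‖aeval α A‖ * ‖aeval α B‖ < 1 := by
    rw [← norm_mul, h1, norm_mul, PadicAlgCl.norm_algebraMap_padicInt]
    exact mul_lt_one_of_nonneg_of_lt_one_left (norm_nonneg _)
      ((PadicInt.norm_lt_one_iff_dvd _).2 dvd_rfl)
      (PadicAlgCl.norm_aeval_le_one hint q)
  rcases lt_or_ge ‖aeval α A‖ 1 with h | h
  · obtain ⟨d, hd⟩ := map_toZMod_dvd_pow_of_norm_lt_one hint hmin' h
    exact ⟨d, Or.inl hd⟩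
  · have h3 : ‖aeval α B‖ < 1 :=
      (le_mul_of_one_le_left (norm_nonneg _) h).trans_lt h2
    obtain ⟨d, hd⟩ := map_toZMod_dvd_pow_of_norm_lt_one hint hmin' h3
    exact ⟨d, Or.inr hd⟩

/-- Modulo `p`, a monic irreducible polynomial of prime degree `r` stays irreducible or becomes the
`r`-th power of a linear polynomial. -/
theorem irreducible_map_toZMod_or_eq_pow {p : ℕ} [Fact p.Prime] {f : ℤ_[p][X]} (hf : f.Monic)
    (hr : f.natDegree.Prime) (hirr : Irreducible f) :
    Irreducible (f.map (PadicInt.toZMod (p := p))) ∨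
      ∃ a : ZMod p, f.map (PadicInt.toZMod (p := p)) = (X - C a) ^ f.natDegree := by
  set F := f.map (PadicInt.toZMod (p := p)) with hF
  have hFm : F.Monic := hf.map _
  have hFd : F.natDegree = f.natDegree := hf.natDegree_map _
  obtain ⟨g, hgm, hg, hgF⟩ := Polynomial.exists_monic_irreducible_factor F
    (not_isUnit_of_natDegree_pos F (hFd ▸ hr.pos))
  obtain ⟨h, hFh, hgh⟩ := (FiniteMultiplicity.of_not_isUnit hg.not_isUnit
    hFm.ne_zero).exists_eq_pow_mul_and_not_dvd
  set k := multiplicity g F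
  have hcop : IsCoprime h g := (hg.coprime_iff_not_dvd.2 hgh).symm
  -- Apply primariness to `F = g ^ k * h`: if `F` divides a power of `g`, then `h` does too and is a
  -- unit by coprimality; if `F` divides a power of `h`, then `g ∣ h`, a contradiction.
  have hunit : IsUnit h := by
    obtain ⟨d, hd | hd⟩ := map_toZMod_dvd_pow_or_dvd_pow hf hirr hFh.dvd
    · have : h ∣ (g ^ k) ^ d := (Dvd.intro_left _ hFh.symm).trans hd
      exact (hcop.pow_right.pow_right).isUnit_of_dvd' dvd_rfl this
    · exact absurd (hg.prime.dvd_of_dvd_pow (hgF.trans hd)) hgh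
  have hFg : F = g ^ k :=
    eq_of_monic_of_associated hFm (hgm.pow k) ⟨hunit.unit⁻¹, by
      rw [hFh, mul_assoc, IsUnit.mul_val_inv, mul_one]⟩
  have hdeg : f.natDegree = k * g.natDegree := by rw [← hFd, hFg, hgm.natDegree_pow]
  rcases (Nat.dvd_prime hr).1 (Dvd.intro_left _ hdeg.symm) with h1 | h1
  · right
    obtain ⟨a, ha⟩ : ∃ a, g = X - C a :=
      ⟨-g.coeff 0, by rw [C_neg, sub_neg_eq_add]; exact hgm.eq_X_add_C h1⟩
    rw [h1, mul_one] at hdeg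
    exact ⟨a, by rw [hFg, ha, hdeg]⟩
  · left
    have hk : k = 1 := by
      rw [h1] at hdeg
      exact Nat.eq_of_mul_eq_mul_right hr.pos (by rw [one_mul]; exact hdeg.symm)
    rwa [hFg, hk, pow_one]

/-! ### Monic polynomials as coefficient vectors -/

/-- The monic polynomial of degree `n` with the given lower coefficients. -/
noncomputable def monicOfVec {R : Type*} [CommRing R] {n : ℕ} (c : Fin n → R) : R[X] :=
  X ^ n + ∑ i : Fin n, C (c i) * X ^ (i : ℕ)

section monicOfVec

variable {R S : Type*} [CommRing R] [CommRing S] {n : ℕ}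

theorem degree_sum_C_mul_X_pow_lt (c : Fin n → R) :
    (∑ i : Fin n, C (c i) * X ^ (i : ℕ)).degree < (n : WithBot ℕ) :=
  (degree_sum_le _ _).trans_lt <| (Finset.sup_lt_iff (WithBot.bot_lt_coe n)).2 fun i _ =>
    (degree_C_mul_X_pow_le _ _).trans_lt (Nat.cast_lt.2 i.2)

theorem coeff_sum_C_mul_X_pow (c : Fin n → R) (i : Fin n) :
    (∑ j : Fin n, C (c j) * X ^ (j : ℕ)).coeff i = c i := by
  simp [coeff_X_pow, Fin.val_inj]

theorem monic_monicOfVec (c : Fin n → R) : (monicOfVec c).Monic :=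
  monic_X_pow_add (degree_sum_C_mul_X_pow_lt c)

theorem natDegree_monicOfVec [Nontrivial R] (c : Fin n → R) : (monicOfVec c).natDegree = n :=
  natDegree_eq_of_degree_eq_some <| by
    rw [monicOfVec, degree_add_eq_left_of_degree_lt, degree_X_pow]
    rw [degree_X_pow]; exact degree_sum_C_mul_X_pow_lt c

theorem coeff_monicOfVec (c : Fin n → R) (i : Fin n) : (monicOfVec c).coeff i = c i := by
  rw [monicOfVec, coeff_add, coeff_sum_C_mul_X_pow, coeff_X_pow, if_neg i.2.ne, zero_add]

theorem monicOfVec_coeff {f : R[X]} (hf : f.Monic) (hn : f.natDegree = n) :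
    monicOfVec (fun i : Fin n => f.coeff i) = f := by
  conv_rhs => rw [hf.as_sum, hn]
  rw [monicOfVec, ← Fin.sum_univ_eq_sum_range (fun i => C (f.coeff i) * X ^ i)]

theorem monicOfVec_injective : Function.Injective (monicOfVec : (Fin n → R) → R[X]) :=
  fun c d h => funext fun i => by rw [← coeff_monicOfVec c, h, coeff_monicOfVec]

theorem map_monicOfVec (φ : R →+* S) (c : Fin n → R) :
    (monicOfVec c).map φ = monicOfVec (fun i => φ (c i)) := by
  simp [monicOfVec, Polynomial.map_sum]

end monicOfVec

/-! ### Counting irreducible polynomials of prime degree over `ZMod p` -/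

-- `f` divides `X ^ p ^ r - X`, which splits in the field with `p ^ r` elements, and `f` is
-- separable because `ZMod p` is perfect.
open Classical in
theorem card_roots_galoisField {p r : ℕ} [Fact p.Prime] (hr : r ≠ 0) {f : (ZMod p)[X]}
    (hirr : Irreducible f) (hdeg : f.natDegree = r) :
    (f.map (algebraMap (ZMod p) (GaloisField p r))).roots.toFinset.card = r := by
  have hdvd : f ∣ X ^ p ^ r - X := by
    have := (hirr.natDegree_dvd_iff_dvd_X_pow_card_pow_sub_X (n := r)).1 hdeg.dvd
    rwa [Nat.card_zmod] at this
  have hdvd' := Polynomial.map_dvd (algebraMap (ZMod p) (GaloisField p r)) hdvd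
  have hsep : (f.map (algebraMap (ZMod p) (GaloisField p r))).Separable :=
    (PerfectField.separable_of_irreducible hirr).map
  have hsplit : (f.map (algebraMap (ZMod p) (GaloisField p r))).Splits :=
    (SplittingField.splits (X ^ p ^ r - X : (ZMod p)[X])).of_dvd
      (Polynomial.map_ne_zero (FiniteField.X_pow_card_pow_sub_X_ne_zero _ hr
        (Fact.out : p.Prime).one_lt)) hdvd'
  rw [Multiset.toFinset_card_of_nodup (nodup_roots hsep), ← hsplit.natDegree_eq_card_roots,
    natDegree_map, hdeg]

theorem minpoly_natDegree_galoisField {p r : ℕ} [Fact p.Prime] (hr : r.Prime)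
    (β : GaloisField p r) (hβ : β ∉ Set.range (algebraMap (ZMod p) (GaloisField p r))) :
    (minpoly (ZMod p) β).natDegree = r := by
  have hint : IsIntegral (ZMod p) β := Algebra.IsIntegral.isIntegral β
  have h := minpoly.degree_dvd hint
  rw [GaloisField.finrank p hr.ne_zero] at h
  refine ((Nat.dvd_prime hr).1 h).resolve_left fun h1 => hβ ?_
  exact minpoly.natDegree_eq_one_iff.1 h1

-- Double counting: sending an element of `GaloisField p r` outside the prime field to its minimal
-- polynomial has fibres of size `r`, the root sets of the irreducible polynomials.
open Classical in
theorem mul_card_irreducible_monicOfVec (p : ℕ) {r : ℕ} [Fact p.Prime] (hr : r.Prime) :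
    r * (Finset.univ.filter fun d : Fin r → ZMod p => Irreducible (monicOfVec d)).card
      = p ^ r - p := by
  have := Fintype.ofFinite (GaloisField p r)
  set K := GaloisField p r
  set S : Finset K := Finset.univ.filter (· ∉ Set.range (algebraMap (ZMod p) K)) with hS
  set T := Finset.univ.filter fun d : Fin r → ZMod p => Irreducible (monicOfVec d) with hT
  set φ : K → (Fin r → ZMod p) := fun β i => (minpoly (ZMod p) β).coeff i with hφ
  have hint (β : K) : IsIntegral (ZMod p) β := Algebra.IsIntegral.isIntegral β
  have hφS : ∀ β ∈ S, monicOfVec (φ β) = minpoly (ZMod p) β := fun β hβ =>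
    monicOfVec_coeff (minpoly.monic (hint β))
      (minpoly_natDegree_galoisField hr β (Finset.mem_filter.1 hβ).2)
  have hmaps : ∀ β ∈ S, φ β ∈ T := fun β hβ => by
    rw [hT, Finset.mem_filter, hφS β hβ]
    exact ⟨Finset.mem_univ _, minpoly.irreducible (hint β)⟩
  have hfib : ∀ d ∈ T, (S.filter fun β => φ β = d).card = r := fun d hd => by
    have hd' : Irreducible (monicOfVec d) := (Finset.mem_filter.1 hd).2
    refine Eq.trans (congrArg Finset.card ?_)
      (card_roots_galoisField hr.ne_zero hd' (natDegree_monicOfVec d))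
    ext β
    rw [Finset.mem_filter, Multiset.mem_toFinset, mem_roots (Polynomial.map_ne_zero hd'.ne_zero),
      IsRoot.def, eval_map_algebraMap]
    constructor
    · rintro ⟨hβ, rfl⟩
      rw [hφS β hβ]
      exact minpoly.aeval _ _
    · intro hβ
      have hmin := minpoly.eq_of_irreducible_of_monic hd' hβ (monic_monicOfVec d)
      have hβS : β ∈ S := by
        rw [hS, Finset.mem_filter]
        refine ⟨Finset.mem_univ _, fun h => hr.one_lt.ne' ?_⟩
        rw [← natDegree_monicOfVec d, hmin]
        exact minpoly.natDegree_eq_one_iff.2 h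
      exact ⟨hβS, monicOfVec_injective (by rw [hφS β hβS, hmin])⟩
  have hcard := Finset.card_eq_sum_card_fiberwise (f := φ) (s := S) (t := T) hmaps
  rw [Finset.sum_congr rfl hfib, Finset.sum_const, smul_eq_mul, mul_comm] at hcard
  rw [← hcard, hS, Finset.filter_not, ← Finset.compl_eq_univ_sdiff, Finset.card_compl,
    ← Nat.card_eq_fintype_card, GaloisField.card p r hr.ne_zero]
  congr 1
  have : (Finset.univ.filter (· ∈ Set.range (algebraMap (ZMod p) K)))
      = Finset.univ.image (algebraMap (ZMod p) K) := by ext; simp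
  rw [this, Finset.card_image_of_injective _ (algebraMap (ZMod p) K).injective, Finset.card_univ,
    ZMod.card]

/-! ### Scaling and translating the roots -/

/-- `scaleRoots` is multiplicative and preserves degrees, so it carries a monic factorization of `g`
to one of the scaled polynomial. -/
theorem irreducible_of_irreducible_scaleRoots {R : Type*} [CommRing R] [IsDomain R] {g : R[X]}
    (hg : g.Monic) {s : R} (h : Irreducible (g.scaleRoots s)) : Irreducible g := by
  have hgs := (monic_scaleRoots_iff s).2 hg
  rw [hgs.irreducible_iff_natDegree] at h
  rw [hg.irreducible_iff_natDegree]
  refine ⟨fun h1 => h.1 (by rw [h1, one_scaleRoots]), fun a b ha hb hab => ?_⟩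
  have := h.2 (a.scaleRoots s) (b.scaleRoots s) ((monic_scaleRoots_iff s).2 ha)
    ((monic_scaleRoots_iff s).2 hb) (by rw [← mul_scaleRoots_of_noZeroDivisors, hab])
  simpa only [natDegree_scaleRoots] using this

/-- By Gauss's lemma both sides may be tested over the fraction field, where scaling by `s` is
undone by scaling by `s⁻¹`. -/
theorem irreducible_scaleRoots_iff {R : Type*} [CommRing R] [IsDomain R] [IsIntegrallyClosed R]
    {g : R[X]} (hg : g.Monic) {s : R} (hs : s ≠ 0) :
    Irreducible (g.scaleRoots s) ↔ Irreducible g := by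
  refine ⟨irreducible_of_irreducible_scaleRoots hg, fun h => ?_⟩
  have hinj := IsFractionRing.injective R (FractionRing R)
  have hgs := (monic_scaleRoots_iff s).2 hg
  rw [hg.irreducible_iff_irreducible_map_fraction_map (K := FractionRing R)] at h
  rw [hgs.irreducible_iff_irreducible_map_fraction_map (K := FractionRing R),
    map_scaleRoots _ _ _ (by rw [hg.leadingCoeff, map_one]; exact one_ne_zero)]
  set t := algebraMap R (FractionRing R) s
  have ht : t ≠ 0 := (map_ne_zero_iff _ hinj).2 hs
  refine irreducible_of_irreducible_scaleRoots (s := t⁻¹)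
    ((monic_scaleRoots_iff t).2 (hg.map _)) ?_
  rwa [← scaleRoots_mul, mul_inv_cancel₀ ht, scaleRoots_one]

theorem irreducible_taylor_iff {R : Type*} [CommRing R] (a : R) {f : R[X]} :
    Irreducible (taylor a f) ↔ Irreducible f :=
  MulEquiv.irreducible_iff (taylorEquiv a)

/-! ### Haar measure on `ℤ_[p] ^ n` -/

section Haar

variable {p n : ℕ} [Fact p.Prime]

/-- Reduction of the `i`-th coordinate modulo `p ^ k i`. -/
noncomputable def powReduction (k : Fin n → ℕ) : (Fin n → ℤ_[p]) →+ (∀ i, ZMod (p ^ k i)) :=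
  AddMonoidHom.mk' (fun c i => PadicInt.toZModPow (k i) (c i)) fun _ _ => funext fun _ => by simp

theorem powReduction_surjective (k : Fin n → ℕ) :
    Function.Surjective (powReduction (p := p) k) := fun d =>
  ⟨fun i => (ZMod.ringHom_surjective (PadicInt.toZModPow (k i)) (d i)).choose, funext fun i =>
    (ZMod.ringHom_surjective (PadicInt.toZModPow (k i)) (d i)).choose_spec⟩

/-- The subgroup of vectors whose `i`-th coordinate is divisible by `p ^ k i`. -/
noncomputable def padicBox (p : ℕ) [Fact p.Prime] (k : Fin n → ℕ) : AddSubgroup (Fin n → ℤ_[p]) :=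
  (powReduction k).ker

theorem mem_padicBox_iff_dvd {k : Fin n → ℕ} {c : Fin n → ℤ_[p]} :
    c ∈ padicBox p k ↔ ∀ i, (p : ℤ_[p]) ^ k i ∣ c i := by
  rw [padicBox, AddMonoidHom.mem_ker, funext_iff]
  refine forall_congr' fun i => ?_
  rw [← Ideal.mem_span_singleton, ← PadicInt.ker_toZModPow, RingHom.mem_ker]
  rfl

theorem mem_padicBox_iff_norm {k : Fin n → ℕ} {c : Fin n → ℤ_[p]} :
    c ∈ padicBox p k ↔ ∀ i, ‖c i‖ ≤ (p : ℝ) ^ (-(k i : ℤ)) := by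
  rw [mem_padicBox_iff_dvd]
  refine forall_congr' fun i => ?_
  rw [PadicInt.norm_le_pow_iff_mem_span_pow, Ideal.mem_span_singleton]

theorem index_padicBox (k : Fin n → ℕ) : (padicBox p k).index = p ^ ∑ i, k i := by
  rw [padicBox, AddSubgroup.index_ker, AddMonoidHom.range_eq_top.2 (powReduction_surjective k),
    AddSubgroup.card_top, Nat.card_pi, ← Finset.prod_pow_eq_pow_sum]
  simp only [Nat.card_zmod]

instance finiteIndex_padicBox (k : Fin n → ℕ) : (padicBox p k).FiniteIndex :=
  ⟨by rw [index_padicBox]; exact pow_ne_zero _ (Fact.out : p.Prime).ne_zero⟩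

theorem isClosed_padicBox (k : Fin n → ℕ) :
    IsClosed (padicBox p k : Set (Fin n → ℤ_[p])) := by
  have : (padicBox p k : Set (Fin n → ℤ_[p])) = ⋂ i, {c | ‖c i‖ ≤ (p : ℝ) ^ (-(k i : ℤ))} := by
    ext c
    rw [SetLike.mem_coe, mem_padicBox_iff_norm, Set.mem_iInter]
    rfl
  rw [this]
  exact isClosed_iInter fun i => isClosed_le (by fun_prop) continuous_const

theorem measurableSet_padicBox (k : Fin n → ℕ) :
    MeasurableSet (padicBox p k : Set (Fin n → ℤ_[p])) := (isClosed_padicBox k).measurableSet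

theorem haarPadicInt_padicBox (k : Fin n → ℕ) :
    haarPadicInt p n (padicBox p k) = ((p : ENNReal) ^ ∑ i, k i)⁻¹ := by
  have h := AddSubgroup.index_mul_measure (padicBox p k) (measurableSet_padicBox k)
    (haarPadicInt p n)
  rw [index_padicBox, measure_univ, Nat.cast_pow] at h
  exact ENNReal.eq_inv_of_mul_eq_one_left (by rwa [mul_comm] at h)

theorem haarPadicInt_real_padicBox (k : Fin n → ℕ) :
    (haarPadicInt p n).real (padicBox p k) = ((p : ℝ) ^ ∑ i, k i)⁻¹ := by
  simp [measureReal_def, haarPadicInt_padicBox]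

/-- Multiplication of the `i`-th coordinate by `p ^ k i`. -/
noncomputable def powScale (k : Fin n → ℕ) : (Fin n → ℤ_[p]) →+ (Fin n → ℤ_[p]) :=
  AddMonoidHom.mk' (fun c i => (p : ℤ_[p]) ^ k i * c i) fun _ _ => funext fun _ => mul_add _ _ _

theorem powScale_apply (k : Fin n → ℕ) (c : Fin n → ℤ_[p]) (i : Fin n) :
    powScale k c i = (p : ℤ_[p]) ^ k i * c i := rfl

theorem range_powScale (k : Fin n → ℕ) :
    Set.range (powScale (p := p) k) = padicBox p k := by
  ext c
  rw [SetLike.mem_coe, mem_padicBox_iff_dvd]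
  constructor
  · rintro ⟨d, rfl⟩ i
    exact Dvd.intro _ rfl
  · intro h
    choose d hd using h
    exact ⟨d, funext fun i => (hd i).symm⟩

theorem isOpenEmbedding_powScale (k : Fin n → ℕ) :
    Topology.IsOpenEmbedding (powScale (p := p) k) := by
  have hcont : Continuous (powScale (p := p) k) :=
    continuous_pi fun i => by simp only [powScale_apply]; fun_prop
  have hinj : Function.Injective (powScale (p := p) k) := fun c d h => funext fun i =>
    mul_left_cancel₀ (pow_ne_zero (k i) (PadicInt.prime_p (p := p)).ne_zero) (congrFun h i)
  refine ⟨(hcont.isClosedEmbedding hinj).isEmbedding, ?_⟩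
  rw [range_powScale]
  exact (padicBox p k).isOpen_of_isClosed_of_finiteIndex (isClosed_padicBox k)

/-- The pullback of Haar measure along the scaling is again a Haar measure, hence proportional to
the original; the factor is read off from the whole group, whose image is the box. -/
theorem haarPadicInt_real_image_powScale (k : Fin n → ℕ) (s : Set (Fin n → ℤ_[p])) :
    (haarPadicInt p n).real (powScale k '' s)
      = ((p : ℝ) ^ ∑ i, k i)⁻¹ * (haarPadicInt p n).real s := by
  have he := isOpenEmbedding_powScale (p := p) k
  set μ := haarPadicInt p n
  have : (μ.comap (powScale k)).IsAddHaarMeasure :=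
    Measure.IsAddHaarMeasure.comap (mH := inferInstance) μ he
  have key : ∀ t : Set (Fin n → ℤ_[p]), μ (powScale k '' t)
      = Measure.addHaarScalarFactor (μ.comap (powScale k)) μ * μ t := fun t => by
    rw [← he.measurableEmbedding.comap_apply]
    exact Measure.measure_isAddInvariant_eq_smul_of_isCompact_closure _ _
      isClosed_closure.isCompact
  have h1 := key Set.univ
  rw [Set.image_univ, range_powScale, measure_univ, mul_one] at h1
  rw [measureReal_def, key, ENNReal.toReal_mul, ← h1, ← measureReal_def, ← measureReal_def,
    haarPadicInt_real_padicBox]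

/-! ### Reduction modulo `p` -/

/-- The vectors with a given reduction modulo `p`. -/
def residueClass (d : Fin n → ZMod p) : Set (Fin n → ℤ_[p]) :=
  {c | ∀ i, PadicInt.toZMod (c i) = d i}

theorem exists_residueClass_eq_image (d : Fin n → ZMod p) :
    ∃ e : Fin n → ℤ_[p], residueClass d =
      (e + ·) ⁻¹' (padicBox p fun _ : Fin n => 1 : Set (Fin n → ℤ_[p])) := by
  choose e he using fun i => toZMod_surjective (p := p) (d i)
  refine ⟨-e, ?_⟩
  ext c
  rw [Set.mem_preimage, SetLike.mem_coe, mem_padicBox_iff_dvd]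
  refine forall_congr' fun i => ?_
  rw [pow_one, ← Ideal.mem_span_singleton, ← PadicInt.maximalIdeal_eq_span_p,
    ← PadicInt.ker_toZMod, RingHom.mem_ker, Pi.add_apply, Pi.neg_apply, map_add, map_neg, he,
    neg_add_eq_zero, eq_comm]

theorem measurableSet_residueClass (d : Fin n → ZMod p) : MeasurableSet (residueClass d) := by
  obtain ⟨e, he⟩ := exists_residueClass_eq_image d
  rw [he]
  exact (measurableSet_padicBox _).preimage (measurable_const_add e)

theorem haarPadicInt_real_residueClass (d : Fin n → ZMod p) :
    (haarPadicInt p n).real (residueClass d) = ((p : ℝ) ^ n)⁻¹ := by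
  obtain ⟨e, he⟩ := exists_residueClass_eq_image d
  rw [he, measureReal_def, measure_preimage_add, ← measureReal_def, haarPadicInt_real_padicBox]
  simp

theorem pairwiseDisjoint_residueClass (s : Set (Fin n → ZMod p)) :
    s.PairwiseDisjoint residueClass := fun _ _ _ _ hde =>
  Set.disjoint_left.2 fun _ hd he => hde (funext fun i => (hd i).symm.trans (he i))

theorem haarPadicInt_real_biUnion_residueClass (T : Finset (Fin n → ZMod p)) :
    (haarPadicInt p n).real (⋃ d ∈ T, residueClass d) = T.card * ((p : ℝ) ^ n)⁻¹ := by
  rw [measureReal_biUnion_finset (pairwiseDisjoint_residueClass _)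
    fun d _ => measurableSet_residueClass d]
  simp [haarPadicInt_real_residueClass]

theorem mem_residueClass_iff {d : Fin n → ZMod p} {c : Fin n → ℤ_[p]} :
    c ∈ residueClass d ↔ (monicOfVec c).map (PadicInt.toZMod (p := p)) = monicOfVec d := by
  rw [map_monicOfVec, monicOfVec_injective.eq_iff, funext_iff]
  rfl

/-! ### Translation of the variable -/

theorem continuous_coeff_monicOfVec (j : ℕ) :
    Continuous fun c : Fin n → ℤ_[p] => (monicOfVec c).coeff j := by
  simp only [monicOfVec, coeff_add, finsetSum_coeff, coeff_C_mul]
  fun_prop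

/-- The linear part of the action of the translation `X ↦ X + a` on coefficient vectors. -/
noncomputable def taylorVec (n : ℕ) (a : ℤ_[p]) : (Fin n → ℤ_[p]) →+ (Fin n → ℤ_[p]) :=
  AddMonoidHom.mk' (fun c i => (taylor a (∑ j : Fin n, C (c j) * X ^ (j : ℕ))).coeff i)
    fun c d => funext fun i => by
      simp [add_mul, Finset.sum_add_distrib]

theorem continuous_taylorVec (a : ℤ_[p]) : Continuous (taylorVec n a) := by
  refine continuous_pi fun i => ?_
  have : (fun c => taylorVec n a c i)
      = fun c => ∑ j : Fin n, c j * (taylor a (X ^ (j : ℕ))).coeff i := by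
    funext c
    change (taylor a (∑ j : Fin n, C (c j) * X ^ (j : ℕ))).coeff i = _
    simp only [map_sum, ← smul_eq_C_mul, map_smul, finsetSum_coeff, coeff_smul, smul_eq_mul]
  rw [this]
  fun_prop

theorem sum_C_coeff_mul_X_pow {R : Type*} [CommRing R] {f : R[X]}
    (hf : f.degree < (n : WithBot ℕ)) : ∑ i : Fin n, C (f.coeff i) * X ^ (i : ℕ) = f := by
  ext j
  rw [finsetSum_coeff]
  simp only [coeff_C_mul, coeff_X_pow]
  rcases lt_or_ge j n with h | h
  · rw [Finset.sum_eq_single ⟨j, h⟩ (fun i _ hi => ?_) (by simp)]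
    · simp
    · rw [if_neg (fun hj => hi (Fin.ext hj.symm)), mul_zero]
  · rw [coeff_eq_zero_of_degree_lt (hf.trans_le (Nat.cast_le.2 h))]
    exact Finset.sum_eq_zero fun i _ => by rw [if_neg (by have := i.2; omega), mul_zero]

theorem taylorVec_surjective (a : ℤ_[p]) : Function.Surjective (taylorVec n a) := fun d => by
  set g : ℤ_[p][X] := ∑ j : Fin n, C (d j) * X ^ (j : ℕ)
  refine ⟨fun i => (taylor (-a) g).coeff i, funext fun i => ?_⟩
  change (taylor a (∑ j : Fin n, C ((taylor (-a) g).coeff j) * X ^ (j : ℕ))).coeff i = d i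
  rw [sum_C_coeff_mul_X_pow, taylor_taylor, add_neg_cancel, taylor_zero]
  · exact coeff_sum_C_mul_X_pow d i
  · rw [degree_taylor]
    exact degree_sum_C_mul_X_pow_lt d

/-- The coefficients of the translate of a monic polynomial. -/
noncomputable def translateVec (n : ℕ) (a : ℤ_[p]) (c : Fin n → ℤ_[p]) : Fin n → ℤ_[p] := fun i =>
  (taylor a (monicOfVec c)).coeff i

theorem monicOfVec_translateVec (a : ℤ_[p]) (c : Fin n → ℤ_[p]) :
    monicOfVec (translateVec n a c) = taylor a (monicOfVec c) :=
  monicOfVec_coeff (by rw [Monic, leadingCoeff_taylor]; exact monic_monicOfVec c)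
    (by rw [natDegree_taylor, natDegree_monicOfVec])

/-- The map is affine: a fixed translation, coming from `X ^ n`, after a continuous surjective
endomorphism of a compact group, and both preserve Haar measure. -/
theorem measurePreserving_translateVec (a : ℤ_[p]) :
    MeasurePreserving (translateVec n a) (haarPadicInt p n) (haarPadicInt p n) := by
  have h := (taylorVec n a).measurePreserving (μ := haarPadicInt p n) (ν := haarPadicInt p n)
    (continuous_taylorVec a) (taylorVec_surjective a) rfl
  have h2 := (measurePreserving_add_left (haarPadicInt p n)
    fun i : Fin n => (taylor a (X ^ n : ℤ_[p][X])).coeff i).comp h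
  convert h2 using 1
  funext c i
  change (taylor a (monicOfVec c)).coeff i = _
  rw [monicOfVec, map_add, coeff_add]
  rfl

/-! ### Irreducibility is an open condition -/

/-- The reducible monic polynomials are a finite union, over the degree `s` of one factor, of images
of compact spaces under multiplication. -/
theorem isClosed_setOf_not_irreducible (hn : n ≠ 0) :
    IsClosed {c : Fin n → ℤ_[p] | ¬ Irreducible (monicOfVec c)} := by
  set P : ∀ s : ℕ, (Fin s → ℤ_[p]) × (Fin (n - s) → ℤ_[p]) → (Fin n → ℤ_[p]) :=
    fun s x i => (monicOfVec x.1 * monicOfVec x.2).coeff i with hP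
  have hcont : ∀ s, Continuous (P s) := fun s => continuous_pi fun i => by
    simp only [hP, coeff_mul]
    exact continuous_finsetSum _ fun j _ =>
      ((continuous_coeff_monicOfVec j.1).comp continuous_fst).mul
        ((continuous_coeff_monicOfVec j.2).comp continuous_snd)
  have heq : {c : Fin n → ℤ_[p] | ¬ Irreducible (monicOfVec c)}
      = ⋃ s ∈ Finset.Ioo 0 n, Set.range (P s) := by
    ext c
    rw [Set.mem_ofPred_eq, (monic_monicOfVec c).irreducible_iff_natDegree]
    have h1 : monicOfVec c ≠ 1 := fun h => hn (by
      rw [← natDegree_monicOfVec c, h, natDegree_one])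
    simp only [Set.mem_iUnion, Finset.mem_Ioo, exists_prop, Set.mem_range]
    constructor
    · intro h
      push Not at h
      obtain ⟨f, g, hf, hg, hfg, hf0, hg0⟩ := h h1
      have hdeg : f.natDegree + g.natDegree = n := by
        rw [← hf.natDegree_mul hg, hfg, natDegree_monicOfVec]
      refine ⟨f.natDegree, by omega, ⟨fun i => f.coeff i, fun i => g.coeff i⟩, ?_⟩
      refine monicOfVec_injective ?_
      simp only [hP]
      rw [monicOfVec_coeff hf rfl, monicOfVec_coeff hg (by omega), hfg]
      simp only [coeff_monicOfVec]
    · rintro ⟨s, hs, ⟨u, v⟩, rfl⟩ ⟨-, h⟩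
      have hm := (monic_monicOfVec u).mul (monic_monicOfVec v)
      have hd : (monicOfVec u * monicOfVec v).natDegree = n := by
        rw [(monic_monicOfVec u).natDegree_mul (monic_monicOfVec v), natDegree_monicOfVec,
          natDegree_monicOfVec]
        omega
      have := h _ _ (monic_monicOfVec u) (monic_monicOfVec v) (monicOfVec_coeff hm hd).symm
      rw [natDegree_monicOfVec, natDegree_monicOfVec] at this
      omega
  rw [heq]
  exact Set.Finite.isClosed_biUnion (Finset.finite_toSet _) fun s _ =>
    (isCompact_range (hcont s)).isClosed

theorem isOpen_irreducibleMonic (hn : n ≠ 0) : IsOpen (irreducibleMonic p n) := by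
  rw [← isClosed_compl_iff]
  exact isClosed_setOf_not_irreducible hn

end Haar

/-! ### Newton segments: exponents, measures and the polynomials congruent to `X ^ r` -/

/-- The natural-number quotient `(N + (r - 1)) / r` is the ceiling of `N / r`. This turns the Newton
condition into membership in a box. -/
theorem PadicInt.norm_pow_le_iff {p : ℕ} [Fact p.Prime] {r : ℕ} (hr : 0 < r) (x : ℤ_[p]) (N : ℕ) :
    ‖x‖ ^ r ≤ (p : ℝ) ^ (-(N : ℤ)) ↔ ‖x‖ ≤ (p : ℝ) ^ (-(((N + (r - 1)) / r : ℕ) : ℤ)) := by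
  have hp1 : (1 : ℝ) < p := by exact_mod_cast (Fact.out : p.Prime).one_lt
  rcases eq_or_ne x 0 with rfl | hx
  · rw [norm_zero, zero_pow hr.ne']
    exact iff_of_true (by positivity) (by positivity)
  · rw [PadicInt.norm_eq_zpow_neg_valuation hx, ← zpow_natCast, ← zpow_mul,
      zpow_le_zpow_iff_right₀ hp1, zpow_le_zpow_iff_right₀ hp1, neg_mul, neg_le_neg_iff,
      neg_le_neg_iff, Nat.cast_le, ← Nat.cast_mul, Nat.cast_le, Nat.div_le_iff_le_mul_add_pred hr,
      mul_comm]
    omega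

section Decomposition

variable {p r : ℕ} [Fact p.Prime]

/-- The least exponents on or above the segment from `(0, m)` to `(r, 0)`. -/
def newtonExp (r m : ℕ) : Fin r → ℕ := fun i => (m * (r - i) + (r - 1)) / r

/-- Pair the indices `j` and `r - j` for `0 < j < r`: the heights `m * (r - j) / r` and `m * j / r`
add up to `m` and neither is an integer, so their ceilings add up to `m + 1`. Index `0` contributes
`m`. -/
theorem two_mul_sum_newtonExp (hr : r.Prime) {m : ℕ} (hm : m ∈ Finset.Ico 1 r) :
    2 * (∑ i, newtonExp r m i + 1) = (m + 1) * (r + 1) := by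
  obtain ⟨s, rfl⟩ : ∃ s, r = s + 1 := ⟨r - 1, by have := hr.pos; omega⟩
  rw [Finset.mem_Ico] at hm
  have h0 : newtonExp (s + 1) m 0 = m := by
    simp only [newtonExp, Fin.val_zero, Nat.sub_zero, Nat.add_sub_cancel]
    rw [mul_comm, Nat.mul_add_div s.succ_pos, Nat.div_eq_of_lt s.lt_succ_self, add_zero]
  have hpair : ∀ i : Fin s, newtonExp (s + 1) m i.succ + newtonExp (s + 1) m i.rev.succ
      = m + 1 := fun i => by
    simp only [newtonExp, Fin.val_succ, Fin.val_rev, Nat.add_sub_cancel]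
    have hi := i.2
    have e1 : s + 1 - (i + 1) = s - i := by omega
    have e2 : s + 1 - (s - (i + 1) + 1) = i + 1 := by omega
    rw [e1, e2]
    have hndvd : ¬ (s + 1) ∣ m * (i + 1) := fun h => by
      rcases (hr.dvd_mul).1 h with h | h
      · exact absurd (Nat.le_of_dvd (by omega) h) (by omega)
      · exact absurd (Nat.le_of_dvd (by omega) h) (by omega)
    have hsum : m * (s - i) + m * (i + 1) = m * (s + 1) := by
      rw [← mul_add]; congr 1; omega
    set A := m * (i + 1 : ℕ)
    set B := m * (s - i : ℕ)
    have hA := Nat.div_add_mod A (s + 1)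
    have hmod : 0 < A % (s + 1) := Nat.pos_of_ne_zero fun h => hndvd (Nat.dvd_of_mod_eq_zero h)
    have hlt := Nat.mod_lt A s.succ_pos
    set u := A / (s + 1)
    set v := A % (s + 1)
    have hum : u < m := by
      by_contra hge
      have := Nat.mul_le_mul_left (s + 1) (not_lt.1 hge)
      rw [mul_comm (s + 1) m] at this
      omega
    have h1 : (A + s) / (s + 1) = u + 1 := by
      rw [show A + s = (s + 1) * (u + 1) + (v - 1) by rw [mul_add]; omega,
        Nat.mul_add_div s.succ_pos, Nat.div_eq_of_lt (by omega), add_zero]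
    have h2 : (B + s) / (s + 1) = m - u := by
      have : (s + 1) * (m - u) + (s + 1) * u = m * (s + 1) := by
        rw [← mul_add, Nat.sub_add_cancel hum.le, mul_comm]
      rw [show B + s = (s + 1) * (m - u) + (s - v) by omega,
        Nat.mul_add_div s.succ_pos, Nat.div_eq_of_lt (by omega), add_zero]
    rw [h1, h2]
    omega
  have hrev : ∑ i : Fin s, newtonExp (s + 1) m i.rev.succ
      = ∑ i : Fin s, newtonExp (s + 1) m i.succ :=
    Equiv.sum_comp Fin.revPerm fun i : Fin s => newtonExp (s + 1) m i.succ
  have htwo : 2 * ∑ i : Fin s, newtonExp (s + 1) m i.succ = s * (m + 1) := by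
    rw [two_mul]
    conv_lhs => arg 2; rw [← hrev]
    rw [← Finset.sum_add_distrib, Finset.sum_congr rfl fun i _ => hpair i]
    simp
  rw [Fin.sum_univ_succ, h0]
  linear_combination htwo

theorem two_mul_sum_sub (r : ℕ) : 2 * ∑ i : Fin r, (r - (i : ℕ)) = r * (r + 1) := by
  rw [Fin.sum_univ_eq_sum_range (fun i => r - i), ← Finset.sum_range_reflect]
  have : ∀ j ∈ Finset.range r, r - (r - 1 - j) = j + 1 := fun j hj => by
    have := Finset.mem_range.1 hj; omega
  rw [Finset.sum_congr rfl this]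
  have h := Finset.sum_range_id_mul_two (r + 1)
  rw [Finset.sum_range_succ'] at h
  simp only [add_zero, Nat.add_sub_cancel] at h
  linarith

/-- The vectors whose Newton polygon is the segment from `(0, m)` to `(r, 0)`. -/
def newtonSegment (p : ℕ) [Fact p.Prime] (r m : ℕ) : Set (Fin r → ℤ_[p]) :=
  {c | c ∈ padicBox p (newtonExp r m) ∧ ∀ i : Fin r, (i : ℕ) = 0 → ‖c i‖ = (p : ℝ) ^ (-(m : ℤ))}

theorem newtonExp_zero (hr : 0 < r) (m : ℕ) : newtonExp r m ⟨0, hr⟩ = m := by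
  simp only [newtonExp, Nat.sub_zero]
  rw [mul_comm, Nat.mul_add_div hr, Nat.div_eq_of_lt (by omega), add_zero]

theorem PadicInt.norm_eq_iff_le_and_not_le {p : ℕ} [Fact p.Prime] (x : ℤ_[p]) (m : ℕ) :
    ‖x‖ = (p : ℝ) ^ (-(m : ℤ)) ↔
      ‖x‖ ≤ (p : ℝ) ^ (-(m : ℤ)) ∧ ¬ ‖x‖ ≤ (p : ℝ) ^ (-((m + 1 : ℕ) : ℤ)) := by
  have hp1 : (1 : ℝ) < p := by exact_mod_cast (Fact.out : p.Prime).one_lt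
  rcases eq_or_ne x 0 with rfl | hx
  · rw [norm_zero]
    refine iff_of_false (by positivity) fun h => h.2 (by positivity)
  · rw [PadicInt.norm_eq_zpow_neg_valuation hx, zpow_le_zpow_iff_right₀ hp1,
      zpow_le_zpow_iff_right₀ hp1, zpow_right_inj₀ (by linarith) hp1.ne']
    omega

/-- Valuation exactly `m` at index `0` means divisibility by `p ^ m` but not by `p ^ (m + 1)`, so
only that exponent is raised in the removed box. -/
theorem newtonSegment_eq_diff (hr : 0 < r) (m : ℕ) :
    newtonSegment p r m = (padicBox p (newtonExp r m) : Set (Fin r → ℤ_[p])) \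
      padicBox p (newtonExp r m + Pi.single ⟨0, hr⟩ 1) := by
  ext c
  rw [Set.mem_sdiff, SetLike.mem_coe, SetLike.mem_coe]
  refine and_congr_right fun hc => ?_
  have hc' := mem_padicBox_iff_norm.1 hc
  have h0 := hc' ⟨0, hr⟩
  rw [newtonExp_zero] at h0
  rw [mem_padicBox_iff_norm]
  have : (∀ i : Fin r, (i : ℕ) = 0 → ‖c i‖ = (p : ℝ) ^ (-(m : ℤ))) ↔
      ‖c ⟨0, hr⟩‖ = (p : ℝ) ^ (-(m : ℤ)) :=
    ⟨fun h => h _ rfl, fun h i hi => by rwa [show i = ⟨0, hr⟩ from Fin.ext hi]⟩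
  rw [this, PadicInt.norm_eq_iff_le_and_not_le, and_iff_right h0, not_iff_not]
  constructor
  · intro h i
    rcases eq_or_ne i ⟨0, hr⟩ with rfl | hi
    · rw [Pi.add_apply, Pi.single_eq_same, newtonExp_zero]
      exact h
    · rw [Pi.add_apply, Pi.single_eq_of_ne hi, add_zero]
      exact hc' i
  · intro h
    have := h ⟨0, hr⟩
    rwa [Pi.add_apply, Pi.single_eq_same, newtonExp_zero] at this

theorem measurableSet_newtonSegment (hr : 0 < r) (m : ℕ) :
    MeasurableSet (newtonSegment p r m) := by
  rw [newtonSegment_eq_diff hr]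
  exact (measurableSet_padicBox _).diff (measurableSet_padicBox _)

theorem haarPadicInt_real_newtonSegment (hr : 0 < r) (m : ℕ) :
    (haarPadicInt p r).real (newtonSegment p r m)
      = ((p : ℝ) - 1) * ((p : ℝ) ^ (∑ i, newtonExp r m i + 1))⁻¹ := by
  have hp0 : (p : ℝ) ≠ 0 := by exact_mod_cast (Fact.out : p.Prime).ne_zero
  have hsub : (padicBox p (newtonExp r m + Pi.single ⟨0, hr⟩ 1) : Set (Fin r → ℤ_[p]))
      ⊆ padicBox p (newtonExp r m) := fun c hc => by
    rw [SetLike.mem_coe, mem_padicBox_iff_dvd] at hc ⊢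
    exact fun i => (pow_dvd_pow _ (Nat.le_add_right _ _)).trans (hc i)
  rw [newtonSegment_eq_diff hr, measureReal_sdiff hsub (measurableSet_padicBox _),
    haarPadicInt_real_padicBox, haarPadicInt_real_padicBox]
  have : ∑ i, (newtonExp r m + Pi.single ⟨0, hr⟩ 1 : Fin r → ℕ) i
      = ∑ i, newtonExp r m i + 1 := by
    simp [Finset.sum_add_distrib]
  rw [this, pow_succ]
  field_simp

/-- This is the self-similarity: multiplying all roots by `p` acts diagonally on coefficients. -/
theorem monicOfVec_powScale (d : Fin r → ℤ_[p]) :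
    monicOfVec (powScale (fun i : Fin r => r - (i : ℕ)) d)
      = (monicOfVec d).scaleRoots (p : ℤ_[p]) := by
  have h := monicOfVec_coeff ((monic_scaleRoots_iff (p : ℤ_[p])).2 (monic_monicOfVec d))
    (n := r) (by rw [natDegree_scaleRoots, natDegree_monicOfVec])
  rw [← h]
  congr 1
  funext i
  rw [coeff_scaleRoots, coeff_monicOfVec, natDegree_monicOfVec, powScale_apply, mul_comm]

theorem powScale_mem_irreducibleMonic_iff (d : Fin r → ℤ_[p]) :
    powScale (fun i : Fin r => r - (i : ℕ)) d ∈ irreducibleMonic p r ↔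
      d ∈ irreducibleMonic p r := by
  change Irreducible (monicOfVec _) ↔ Irreducible (monicOfVec d)
  rw [monicOfVec_powScale,
    irreducible_scaleRoots_iff (monic_monicOfVec d) (PadicInt.prime_p (p := p)).ne_zero]

theorem mem_residueClass_zero_iff {c : Fin r → ℤ_[p]} :
    c ∈ residueClass (0 : Fin r → ZMod p) ↔ ∀ i, (p : ℤ_[p]) ∣ c i := by
  refine forall_congr' fun i => ?_
  rw [← Ideal.mem_span_singleton, ← PadicInt.maximalIdeal_eq_span_p, ← PadicInt.ker_toZMod,
    RingHom.mem_ker, Pi.zero_apply]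

theorem newtonSegment_subset_irreducibleMonic (hr : r.Prime) {m : ℕ} (hm : m ∈ Finset.Ico 1 r) :
    newtonSegment p r m ⊆ irreducibleMonic p r := by
  rintro c ⟨hc, h0⟩
  rw [Finset.mem_Ico] at hm
  have hdeg := natDegree_monicOfVec c
  have hcoeff0 : (monicOfVec c).coeff 0 = c ⟨0, hr.pos⟩ := coeff_monicOfVec c ⟨0, hr.pos⟩
  change Irreducible (monicOfVec c)
  refine irreducible_of_newton_segment (monic_monicOfVec c) (m := m) (by rwa [hdeg]) ?_ ?_ ?_
  · rw [hdeg]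
    exact fun h => absurd (Nat.le_of_dvd (by omega) h) (by omega)
  · rw [hcoeff0, h0 _ rfl]
  · intro i hi
    rw [hdeg] at hi ⊢
    rw [hcoeff0, h0 _ rfl, ← zpow_natCast _ (r - i), ← zpow_mul, neg_mul, ← Nat.cast_mul,
      PadicInt.norm_pow_le_iff hr.pos, show (monicOfVec c).coeff i = c ⟨i, hi⟩ from
        coeff_monicOfVec c ⟨i, hi⟩]
    exact mem_padicBox_iff_norm.1 hc ⟨i, hi⟩

theorem newtonExp_pos {m : ℕ} (hm : 1 ≤ m) (i : Fin r) : newtonExp r m i ≠ 0 := by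
  have hi := i.2
  refine (Nat.div_pos ?_ (by omega)).ne'
  have : 1 * 1 ≤ m * (r - i) := Nat.mul_le_mul hm (by omega)
  omega

/-- The irreducible polynomials congruent to `X ^ r` modulo `p`, sorted by the valuation of the
constant coefficient. -/
theorem irreducibleMonic_inter_residueClass_zero (hr : r.Prime) :
    irreducibleMonic p r ∩ residueClass (0 : Fin r → ZMod p)
      = (⋃ m ∈ Finset.Ico 1 r, newtonSegment p r m) ∪
        powScale (fun i : Fin r => r - (i : ℕ)) '' irreducibleMonic p r := by
  have hp1 : (1 : ℝ) < p := by exact_mod_cast (Fact.out : p.Prime).one_lt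
  ext c
  constructor
  · rintro ⟨hirr, hc⟩
    rw [mem_residueClass_zero_iff] at hc
    have hdeg := natDegree_monicOfVec c
    have hnewton : ∀ i : Fin r, ‖c i‖ ^ r ≤ ‖c ⟨0, hr.pos⟩‖ ^ (r - i) := fun i => by
      have := norm_coeff_pow_le_of_irreducible (monic_monicOfVec c) hirr (i := i)
        (by rw [hdeg]; exact i.2)
      rw [hdeg, coeff_monicOfVec] at this
      rwa [show (monicOfVec c).coeff 0 = c ⟨0, hr.pos⟩ from
        coeff_monicOfVec c ⟨0, hr.pos⟩] at this
    -- At valuation at least `r` the segment has slope at least `1` in absolute value, so `p ^ (r -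
    -- i)` divides the `i`-th coefficient and the roots can be divided by `p`.
    by_cases hlarge : ‖c ⟨0, hr.pos⟩‖ ≤ (p : ℝ) ^ (-(r : ℤ))
    · right
      have : c ∈ padicBox p fun i : Fin r => r - (i : ℕ) := by
        rw [mem_padicBox_iff_norm]
        intro i
        refine le_of_pow_le_pow_left₀ hr.ne_zero (by positivity) ((hnewton i).trans ?_)
        refine (pow_le_pow_left₀ (norm_nonneg _) hlarge _).trans (le_of_eq ?_)
        rw [← zpow_natCast, ← zpow_natCast, ← zpow_mul, ← zpow_mul]
        congr 1
        ring
      rw [← SetLike.mem_coe, ← range_powScale] at this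
      obtain ⟨d, rfl⟩ := this
      exact ⟨d, (powScale_mem_irreducibleMonic_iff d).1 hirr, rfl⟩
    · left
      have hne : c ⟨0, hr.pos⟩ ≠ 0 := fun h => hlarge (by rw [h, norm_zero]; positivity)
      have hval := PadicInt.norm_eq_zpow_neg_valuation hne
      set m := (c ⟨0, hr.pos⟩).valuation
      rw [hval, zpow_le_zpow_iff_right₀ hp1] at hlarge
      have h1 : ‖c ⟨0, hr.pos⟩‖ < 1 := (PadicInt.norm_lt_one_iff_dvd _).2 (hc _)
      have hm1 : 1 ≤ m := by
        by_contra h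
        rw [hval, show m = 0 by omega] at h1
        simp at h1
      simp only [Set.mem_iUnion]
      refine ⟨m, Finset.mem_Ico.2 ⟨hm1, by omega⟩, mem_padicBox_iff_norm.2 fun i => ?_,
        fun i hi => by rw [show i = ⟨0, hr.pos⟩ from Fin.ext hi, hval]⟩
      have := hnewton i
      rw [hval, ← zpow_natCast _ (r - i), ← zpow_mul, neg_mul, ← Nat.cast_mul,
        PadicInt.norm_pow_le_iff hr.pos] at this
      exact this
  · rintro (h | ⟨d, hd, rfl⟩)
    · simp only [Set.mem_iUnion] at h
      obtain ⟨m, hm, hc⟩ := h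
      refine ⟨newtonSegment_subset_irreducibleMonic hr hm hc, mem_residueClass_zero_iff.2 fun i =>
        (dvd_pow_self _ (newtonExp_pos (Finset.mem_Ico.1 hm).1 i)).trans
          (mem_padicBox_iff_dvd.1 hc.1 i)⟩
    · refine ⟨(powScale_mem_irreducibleMonic_iff d).2 hd, mem_residueClass_zero_iff.2 fun i =>
        Dvd.dvd.mul_right (dvd_pow_self _ (Nat.sub_ne_zero_of_lt i.2)) _⟩

theorem haarPadicInt_real_irreducibleMonic_inter_residueClass_zero (hr : r.Prime) :
    (haarPadicInt p r).real (irreducibleMonic p r ∩ residueClass (0 : Fin r → ZMod p))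
      = ∑ m ∈ Finset.Ico 1 r, ((p : ℝ) - 1) * ((p : ℝ) ^ (∑ i, newtonExp r m i + 1))⁻¹ +
        ((p : ℝ) ^ ∑ i : Fin r, (r - (i : ℕ)))⁻¹ *
          (haarPadicInt p r).real (irreducibleMonic p r) := by
  have hp1 : (1 : ℝ) < p := by exact_mod_cast (Fact.out : p.Prime).one_lt
  have hmeas := (isOpen_irreducibleMonic (p := p) hr.ne_zero).measurableSet
  rw [irreducibleMonic_inter_residueClass_zero hr, measureReal_union _
    ((isOpenEmbedding_powScale _).measurableEmbedding.measurableSet_image.2 hmeas)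
    (measure_ne_top _ _) (measure_ne_top _ _),
    measureReal_biUnion_finset _ fun m _ => measurableSet_newtonSegment hr.pos m,
    haarPadicInt_real_image_powScale]
  · simp only [haarPadicInt_real_newtonSegment hr.pos]
  · intro m _ m' _ hmm
    refine Set.disjoint_left.2 fun c hc hc' => hmm ?_
    have := (hc.2 ⟨0, hr.pos⟩ rfl).symm.trans (hc'.2 ⟨0, hr.pos⟩ rfl)
    have := zpow_right_injective₀ (by linarith) hp1.ne' this
    omega
  -- The constant coefficient has valuation `m < r` on a segment and at least `r` on the scaled
  -- copy.
  · rw [Set.disjoint_iUnion₂_left]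
    intro m hm
    rw [Set.disjoint_left]
    rintro _ hc ⟨d, -, rfl⟩
    have h1 := hc.2 ⟨0, hr.pos⟩ rfl
    rw [powScale_apply, norm_mul, PadicInt.norm_p_pow, Nat.sub_zero] at h1
    have h2 : (p : ℝ) ^ (-(m : ℤ)) ≤ (p : ℝ) ^ (-(r : ℤ)) :=
      h1 ▸ mul_le_of_le_one_right (by positivity) (PadicInt.norm_le_one _)
    rw [zpow_le_zpow_iff_right₀ hp1] at h2
    have := (Finset.mem_Ico.1 hm).2
    omega

/-! ### Assembling the residue classes -/

/-- The coefficient vector of `(X - a) ^ r`. -/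
noncomputable def linPowVec (r : ℕ) (a : ZMod p) : Fin r → ZMod p :=
  fun i => ((X - C a) ^ r : (ZMod p)[X]).coeff i

theorem monicOfVec_linPowVec (a : ZMod p) :
    monicOfVec (linPowVec r a) = ((X - C a) ^ r : (ZMod p)[X]) :=
  monicOfVec_coeff ((monic_X_sub_C a).pow r) (by
    rw [(monic_X_sub_C a).natDegree_pow, natDegree_X_sub_C, mul_one])

theorem linPowVec_zero : linPowVec r (0 : ZMod p) = 0 := by
  funext i
  rw [linPowVec, C_0, sub_zero, coeff_X_pow, if_neg i.2.ne, Pi.zero_apply]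

theorem linPowVec_injective (hr : r ≠ 0) : Function.Injective (linPowVec (p := p) r) :=
  fun a b hab => by
    have h := congrArg (fun f => eval a (monicOfVec f)) hab
    simp only [monicOfVec_linPowVec, eval_pow, eval_sub, eval_X, eval_C, sub_self,
      zero_pow hr] at h
    exact sub_eq_zero.1 (pow_eq_zero_iff hr |>.1 h.symm)

/-- The substitution `X ↦ X + a` turns `(X - a) ^ r` into `X ^ r` and preserves irreducibility. -/
theorem preimage_translateVec (a : ℤ_[p]) :
    translateVec r a ⁻¹' (irreducibleMonic p r ∩ residueClass (0 : Fin r → ZMod p))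
      = irreducibleMonic p r ∩ residueClass (linPowVec r (PadicInt.toZMod a)) := by
  ext c
  refine and_congr ?_ ?_
  · change Irreducible (monicOfVec (translateVec r a c)) ↔ Irreducible (monicOfVec c)
    rw [monicOfVec_translateVec, irreducible_taylor_iff]
  · rw [← linPowVec_zero, mem_residueClass_iff, mem_residueClass_iff, monicOfVec_translateVec,
      monicOfVec_linPowVec, monicOfVec_linPowVec, map_taylor,
      ← (taylor_injective (PadicInt.toZMod a)).eq_iff (a := (monicOfVec c).map _)]
    simp [taylor_pow]

theorem haarPadicInt_real_irreducibleMonic_inter_residueClass_linPowVec (hr : r ≠ 0)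
    (a : ZMod p) :
    (haarPadicInt p r).real (irreducibleMonic p r ∩ residueClass (linPowVec r a))
      = (haarPadicInt p r).real (irreducibleMonic p r ∩ residueClass (0 : Fin r → ZMod p)) := by
  obtain ⟨a, rfl⟩ := toZMod_surjective a
  rw [← preimage_translateVec, measureReal_def, (measurePreserving_translateVec a).measure_preimage,
    ← measureReal_def]
  exact ((isOpen_irreducibleMonic hr).measurableSet.inter
    (measurableSet_residueClass _)).nullMeasurableSet

open Classical in
theorem irreducibleMonic_eq_union (hr : r.Prime) :
    irreducibleMonic p r =
      (⋃ d ∈ Finset.univ.filter fun d : Fin r → ZMod p => Irreducible (monicOfVec d),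
        residueClass d) ∪
      ⋃ a ∈ (Finset.univ : Finset (ZMod p)),
        irreducibleMonic p r ∩ residueClass (linPowVec r a) := by
  ext c
  simp only [Set.mem_union, Set.mem_iUnion, Finset.mem_filter, Finset.mem_univ, true_and,
    exists_prop, Set.mem_inter_iff, exists_and_left]
  constructor
  · intro hc
    rcases irreducible_map_toZMod_or_eq_pow (monic_monicOfVec c)
      (by rwa [natDegree_monicOfVec]) hc with h | ⟨a, ha⟩
    · rw [map_monicOfVec] at h
      exact Or.inl ⟨_, h, fun i => rfl⟩
    · rw [natDegree_monicOfVec] at ha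
      exact Or.inr ⟨hc, a, mem_residueClass_iff.2 (by rw [ha, monicOfVec_linPowVec])⟩
  · rintro (⟨d, hd, hc⟩ | h)
    · rw [← mem_residueClass_iff.1 hc] at hd
      exact (monic_monicOfVec c).irreducible_of_irreducible_map _ _ hd
    · exact h.1

open Classical in
theorem haarPadicInt_real_irreducibleMonic_eq_add (hr : r.Prime) :
    (haarPadicInt p r).real (irreducibleMonic p r) =
      (Finset.univ.filter fun d : Fin r → ZMod p => Irreducible (monicOfVec d)).card *
          ((p : ℝ) ^ r)⁻¹ +
        p * (haarPadicInt p r).real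
          (irreducibleMonic p r ∩ residueClass (0 : Fin r → ZMod p)) := by
  have hmeas (a : ZMod p) :
      MeasurableSet (irreducibleMonic p r ∩ residueClass (linPowVec r a)) :=
    (isOpen_irreducibleMonic hr.ne_zero).measurableSet.inter (measurableSet_residueClass _)
  conv_lhs => rw [irreducibleMonic_eq_union hr]
  rw [measureReal_union _ (Finset.measurableSet_biUnion _ fun a _ => hmeas a)
      (measure_ne_top _ _) (measure_ne_top _ _),
    haarPadicInt_real_biUnion_residueClass, measureReal_biUnion_finset _ fun a _ => hmeas a]
  · simp only [haarPadicInt_real_irreducibleMonic_inter_residueClass_linPowVec hr.ne_zero]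
    simp
  · intro a _ b _ hab
    exact (pairwiseDisjoint_residueClass Set.univ trivial trivial
      ((linPowVec_injective hr.ne_zero).ne hab)).mono Set.inter_subset_right
      Set.inter_subset_right
  · rw [Set.disjoint_iUnion₂_left]
    intro d hd
    rw [Set.disjoint_iUnion₂_right]
    intro a _
    refine (pairwiseDisjoint_residueClass Set.univ trivial trivial ?_).mono_right
      Set.inter_subset_right
    -- A class in both unions would make `(X - a) ^ r` irreducible.
    rintro rfl
    have := (Finset.mem_filter.1 hd).2
    rw [monicOfVec_linPowVec] at this
    exact not_irreducible_pow hr.ne_one this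

end Decomposition

/-! ### Solving the linear equation -/

theorem theorem3p1 (p r : ℕ) [Fact p.Prime] (hr : r.Prime) (hrp : r ≠ p) :
    MeasurableSet (irreducibleMonic p r) ∧
      (haarPadicInt p r).real (irreducibleMonic p r) =
        (((p : ℝ) ^ r - (p : ℝ)) * (1 - (p : ℝ) ^ (-((r : ℝ) + 1) / 2)) +
            (r : ℝ) * ((p : ℝ) - 1) *
              (1 - (p : ℝ) ^ (-(((r : ℝ) + 1) * ((r : ℝ) - 1)) / 2))) /
          ((r : ℝ) * (p : ℝ) ^ r *
            (1 - (p : ℝ) ^ (-((r : ℝ) * ((r : ℝ) + 1)) / 2 + 1)) *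
              (1 - (p : ℝ) ^ (-((r : ℝ) + 1) / 2))) := by
  classical
  refine ⟨(isOpen_irreducibleMonic hr.ne_zero).measurableSet, ?_⟩
  have hp1 : (1 : ℝ) < p := by exact_mod_cast (Fact.out : p.Prime).one_lt
  have hp0 : (0 : ℝ) < p := by linarith
  have hr2 := hr.two_le
  have hr0 : (r : ℝ) ≠ 0 := by exact_mod_cast hr.ne_zero
  -- All box exponents are multiples of `(r + 1) / 2`, so the measures become powers of `q`; the
  -- doubled exponent identities avoid halving in `ℕ`.
  set q : ℝ := (p : ℝ) ^ (-((r : ℝ) + 1) / 2) with hq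
  have hq0 : 0 < q := Real.rpow_pos_of_pos hp0 _
  have hqpow (k : ℕ) : q ^ k = (p : ℝ) ^ (-((r : ℝ) + 1) / 2 * k) := by
    rw [hq, Real.rpow_mul_natCast hp0.le]
  have hinv {k e : ℕ} (h : 2 * e = k * (r + 1)) : ((p : ℝ) ^ e)⁻¹ = q ^ k := by
    rw [hqpow, ← Real.rpow_natCast, ← Real.rpow_neg hp0.le]
    congr 1
    have : (2 : ℝ) * e = k * (r + 1) := by exact_mod_cast h
    linarith
  have hq2 : q ^ 2 * (p ^ r * p) = 1 := by
    rw [← hinv (e := r + 1) (by ring), pow_succ]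
    exact inv_mul_cancel₀ (by positivity)
  have hq1 : q < 1 := Real.rpow_lt_one_of_one_lt_of_neg hp1 (by
    have : (0 : ℝ) ≤ r := Nat.cast_nonneg r
    linarith)
  have hB : (p : ℝ) ^ (-(((r : ℝ) + 1) * ((r : ℝ) - 1)) / 2) = q ^ (r - 1) := by
    rw [hqpow, Nat.cast_sub hr.one_le, Nat.cast_one]
    congr 1
    ring
  have hC : (p : ℝ) ^ (-((r : ℝ) * ((r : ℝ) + 1)) / 2 + 1) = q ^ r * p := by
    rw [Real.rpow_add hp0, Real.rpow_one, hqpow]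
    congr 2
    ring
  -- This makes the coefficient `1 - q ^ r * p` of `I` nonzero, so the equation determines `I`.
  have hqr : q ^ r * p < 1 := by
    have h1 : q ^ r ≤ q ^ 2 := pow_le_pow_of_le_one hq0.le hq1.le hr2
    have h2 : (1 : ℝ) < p ^ r := one_lt_pow₀ hp1 hr.ne_zero
    calc q ^ r * p ≤ q ^ 2 * p := mul_le_mul_of_nonneg_right h1 hp0.le
      _ < q ^ 2 * p * p ^ r := lt_mul_of_one_lt_right (by positivity) h2
      _ = 1 := by rw [← hq2]; ring
  have hN : (r : ℝ) * (Finset.univ.filter fun d : Fin r → ZMod p =>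
      Irreducible (monicOfVec d)).card = p ^ r - p := by
    rw [← Nat.cast_mul, mul_card_irreducible_monicOfVec p hr, Nat.cast_sub, Nat.cast_pow]
    exact Nat.le_self_pow hr.ne_zero p
  have hgeom : (∑ m ∈ Finset.Ico 1 r, ((p : ℝ) - 1) * ((p : ℝ) ^ (∑ i, newtonExp r m i + 1))⁻¹)
      * (1 - q) = (p - 1) * q ^ 2 * (1 - q ^ (r - 1)) := by
    rw [Finset.sum_congr rfl fun m hm => by rw [hinv (two_mul_sum_newtonExp hr hm)],
      ← Finset.mul_sum, Finset.sum_Ico_eq_sum_range]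
    have : ∀ j, q ^ (1 + j + 1) = q ^ 2 * q ^ j := fun j => by ring
    simp only [this]
    rw [← Finset.mul_sum, ← mul_neg_geom_sum q (r - 1)]
    ring
  have hI := haarPadicInt_real_irreducibleMonic_eq_add (p := p) hr
  rw [haarPadicInt_real_irreducibleMonic_inter_residueClass_zero hr,
    hinv (k := r) (two_mul_sum_sub r)] at hI
  rw [hB, hC]
  set I := (haarPadicInt p r).real (irreducibleMonic p r)
  set S := ∑ m ∈ Finset.Ico 1 r, ((p : ℝ) - 1) * ((p : ℝ) ^ (∑ i, newtonExp r m i + 1))⁻¹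
  set N : ℝ := ((Finset.univ.filter fun d : Fin r → ZMod p =>
      Irreducible (monicOfVec d)).card : ℝ)
  have hP : (p : ℝ) ^ r ≠ 0 := by positivity
  have h1q : 1 - q ≠ 0 := by linarith
  have h1r : 1 - q ^ r * p ≠ 0 := by linarith
  rw [eq_div_iff (by positivity)]
  have hI' : I * p ^ r = N + p ^ r * (p * (S + q ^ r * I)) := by
    have := congrArg (· * (p : ℝ) ^ r) hI
    simp only [add_mul, inv_mul_cancel_right₀ hP] at this
    linear_combination this
  -- Clear the denominator `r * (1 - q)`, insert `N` and the geometric sum, and cancel `q ^ 2 * p ^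
  -- (r + 1) = 1`.
  linear_combination (r : ℝ) * (1 - q) * hI' + (1 - q) * hN + (r : ℝ) * p ^ r * p * hgeom
    + (r : ℝ) * (p - 1) * (1 - q ^ (r - 1)) * hq2
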